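/- Let $n\ge 0$ and let $H$ be an $n\times n$ complex matrix that is a contraction, i.e. its operator norm with respect to the Euclidean norm on $\mathbb{C}^n$ satisfies $\|H\|\le 1$. For positive definite $n\times n$ complex matrices $A$ and $B$ define the reduced relative quantum entropy by $$S_H(A\mid B)=\operatorname{Tr}\bigl(A\log A-H^*AH\log B-A+B\bigr),$$ where $\log$ is the matrix logarithm given by the functional calculus. Then $S_H(A\mid B)$ is a real number for all such $A,B$, and the function $(A,B)\mapsto S_H(A\mid B)$ is jointly convex: for all positive definite $A_1,A_2,B_1,B_2$ and all $t\in[0,1]$, $$S_H\bigl(tA_1+(1-t)A_2\mid tB_1+(1-t)B_2\bigr)\le t\,S_H(A_1\mid B_1)+(1-t)\,S_H(A_2\mid B_2).$$ (For $H=I$ this is the joint convexity of the quantum relative entropy $\operatorname{Tr}(A\log A-A\log B-A+B)$.) -/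

import Mathlib

open scoped Matrix Matrix.Norms.L2Operator ComplexOrder

/-- The complex number `Tr (A log A - H* A H log B - A + B)`, with the logarithm of a matrix taken
in the sense of the functional calculus. -/
noncomputable def reducedRelativeEntropyTrace {n : Type*} [Fintype n] [DecidableEq n]
    (H A B : Matrix n n ℂ) : ℂ :=
  (A * CFC.log A - Hᴴ * A * H * CFC.log B - A + B).trace

/-- The reduced relative quantum entropy `S_H(A | B)` as a real number. (For positive definite `A`
and `B` the trace is real, so that taking the real part loses nothing.) -/
noncomputable def reducedRelativeEntropy {n : Type*} [Fintype n] [DecidableEq n]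
    (H A B : Matrix n n ℂ) : ℝ :=
  (reducedRelativeEntropyTrace H A B).re

/-- A square complex matrix is a contraction if its operator norm, with respect to the Euclidean
norm on vectors, is at most one. -/
def IsContractionMatrix {n : Type*} [Fintype n] [DecidableEq n] (H : Matrix n n ℂ) : Prop :=
  ‖H‖ ≤ 1

open MeasureTheory Set Filter Topology

/-! ### Scalar integral representation of the logarithm difference -/

section ScalarIntegral

variable {a b : ℝ}

/-! Write `L_K(A, B)` for `liebEntropy K A B`. Since `H` is a contraction, some `K` satisfies `H H*
+ K K* = 1`; cyclicity of the trace then splits `Tr A log A`, so that `S_H(A | B) = L_H(A, B) +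
L_K(A, 1) + Tr B - Tr A`. It remains to see that `L_K` is jointly convex for every `K`.

For scalars, `a log a - a log b = ∫₀^∞ (a/(1+s) - ab/(a+sb)) ds`. Applied to the eigenvalues of left
multiplication by `A` and right multiplication by `B`, this writes `L_K` as an integral of a term
linear in `A` minus the parallel sum of `A/s` and `B`, taken as a quadratic form at `K`. That form
is a minimum over `X` of `parallelFunctional`, which is linear in `(A, B)`, hence it is concave. -/

theorem hasDerivAt_mul_log_sub_mul_log (ha : 0 < a) (hb : 0 < b) {s : ℝ} (hs : 0 ≤ s) :
    HasDerivAt (fun s => a * Real.log (1 + s) - a * Real.log (a + s * b))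
      (a / (1 + s) - a * b / (a + s * b)) s := by
  have h1 : HasDerivAt (fun s : ℝ => 1 + s) 1 s := (hasDerivAt_id s).const_add 1
  have h2 : HasDerivAt (fun s : ℝ => a + s * b) b s := by
    simpa using ((hasDerivAt_id s).mul_const b).const_add a
  have h := ((h1.log (by positivity)).const_mul a).sub ((h2.log (by positivity)).const_mul a)
  refine h.congr_deriv ?_
  ring

theorem tendsto_mul_log_sub_mul_log (ha : 0 < a) (hb : 0 < b) :
    Tendsto (fun s => a * Real.log (1 + s) - a * Real.log (a + s * b)) atTop
      (𝓝 (-(a * Real.log b))) := by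
  have hinv : Tendsto (fun s : ℝ => s⁻¹) atTop (𝓝 0) := tendsto_inv_atTop_zero
  have h : Tendsto (fun s : ℝ => (s⁻¹ + 1) / (a * s⁻¹ + b)) atTop (𝓝 ((0 + 1) / (a * 0 + b))) :=
    (hinv.add_const 1).div ((hinv.const_mul a).add_const b) (by simpa using hb.ne')
  have h' := (h.log (by simpa using hb.ne')).const_mul a
  have e : a * Real.log ((0 + 1) / (a * 0 + b)) = -(a * Real.log b) := by simp
  rw [e] at h'
  refine h'.congr' ?_
  filter_upwards [eventually_gt_atTop 0] with s hs
  rw [← mul_sub, ← Real.log_div (by positivity) (by positivity)]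
  congr 2
  field_simp

theorem integrableOn_div_sub_parallel (ha : 0 < a) (hb : 0 < b) :
    IntegrableOn (fun s => a / (1 + s) - a * b / (a + s * b)) (Ioi 0) := by
  -- The sign is that of `a - b` for all `s`, so convergence of the antiderivative gives
  -- integrability.
  have key : ∀ s ∈ Ioi (0 : ℝ), a / (1 + s) - a * b / (a + s * b)
      = a * (a - b) / ((1 + s) * (a + s * b)) := by
    intro s hs
    have hs : 0 < s := hs
    field_simp
    ring
  rcases le_total b a with h | h
  · refine integrableOn_Ioi_deriv_of_nonneg'
      (fun s hs => hasDerivAt_mul_log_sub_mul_log ha hb hs) (fun s hs => ?_)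
      (tendsto_mul_log_sub_mul_log ha hb)
    rw [key s hs]
    have hs : 0 < s := hs
    have := sub_nonneg.2 h
    positivity
  · refine integrableOn_Ioi_deriv_of_nonpos'
      (fun s hs => hasDerivAt_mul_log_sub_mul_log ha hb hs) (fun s hs => ?_)
      (tendsto_mul_log_sub_mul_log ha hb)
    rw [key s hs]
    have hs : 0 < s := hs
    exact div_nonpos_of_nonpos_of_nonneg
      (mul_nonpos_of_nonneg_of_nonpos ha.le (sub_nonpos.2 h)) (by positivity)

theorem integral_div_sub_parallel (ha : 0 < a) (hb : 0 < b) :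
    ∫ s in Ioi (0 : ℝ), (a / (1 + s) - a * b / (a + s * b))
      = a * Real.log a - a * Real.log b := by
  rw [integral_Ioi_of_hasDerivAt_of_tendsto'
    (fun s hs => hasDerivAt_mul_log_sub_mul_log ha hb hs)
    (integrableOn_div_sub_parallel ha hb) (tendsto_mul_log_sub_mul_log ha hb)]
  simp
  ring

end ScalarIntegral

/-- Completing the square in `x`; the minimizer is `x = s b / (a + s b) * w`. -/
theorem parallel_mul_normSq_le {a b s : ℝ} (ha : 0 < a) (hb : 0 < b) (hs : 0 < s) (w x : ℂ) :
    a * b / (a + s * b) * Complex.normSq w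
      ≤ a * Complex.normSq x / s + b * Complex.normSq (w - x) := by
  have h : a * Complex.normSq x / s + b * Complex.normSq (w - x)
      - a * b / (a + s * b) * Complex.normSq w
      = (a + s * b) / s * Complex.normSq (x - ((s * b / (a + s * b) : ℝ) : ℂ) * w) := by
    simp only [Complex.normSq_apply, Complex.sub_re, Complex.sub_im, Complex.re_ofReal_mul,
      Complex.im_ofReal_mul]
    field_simp
    ring
  have h' : 0 ≤ (a + s * b) / s * Complex.normSq (x - ((s * b / (a + s * b) : ℝ) : ℂ) * w) :=
    mul_nonneg (by positivity) (Complex.normSq_nonneg _)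
  linarith

theorem parallel_mul_normSq_eq {a b s : ℝ} (ha : 0 < a) (hb : 0 < b) (hs : 0 < s) (w : ℂ) :
    a * b / (a + s * b) * Complex.normSq w
      = a * Complex.normSq (((s * b / (a + s * b) : ℝ) : ℂ) * w) / s
        + b * Complex.normSq (w - ((s * b / (a + s * b) : ℝ) : ℂ) * w) := by
  simp only [Complex.normSq_apply, Complex.sub_re, Complex.sub_im, Complex.re_ofReal_mul,
    Complex.im_ofReal_mul]
  field_simp
  ring

/-! ### Matrix functionals in eigenbases -/

namespace Matrix

theorem PosDef.convexComb {n : Type*} {A₁ A₂ : Matrix n n ℂ} (h₁ : A₁.PosDef) (h₂ : A₂.PosDef) {p q : ℝ}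
    (hp : 0 ≤ p) (hq : 0 ≤ q) (hpq : p + q = 1) : (p • A₁ + q • A₂).PosDef := by
  rcases hp.eq_or_lt with rfl | hp
  · obtain rfl : q = 1 := by linarith
    simpa using h₂
  · exact (h₁.smul hp).add_posSemidef (h₂.posSemidef.smul hq)

variable {n : Type*} [Fintype n]

/-- The functional `X ↦ Tr (X* A X) / s + Tr ((K - X)* (K - X) B)`, whose minimum over `X` is the
quadratic form at `K` of the parallel sum of left multiplication by `A / s` and right
multiplication by `B`. -/
noncomputable def parallelFunctional (K A B : Matrix n n ℂ) (s : ℝ) (X : Matrix n n ℂ) : ℝ :=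
  (Xᴴ * A * X).trace.re / s + ((K - X)ᴴ * (K - X) * B).trace.re

theorem parallelFunctional_convexComb (K A₁ A₂ B₁ B₂ X : Matrix n n ℂ) (s p q : ℝ) :
    parallelFunctional K (p • A₁ + q • A₂) (p • B₁ + q • B₂) s X
      = p * parallelFunctional K A₁ B₁ s X + q * parallelFunctional K A₂ B₂ s X := by
  simp only [parallelFunctional, Matrix.mul_add, Matrix.add_mul, Matrix.mul_smul, Matrix.smul_mul,
    trace_add, trace_smul, Complex.add_re, Complex.smul_re, smul_eq_mul]
  ring

theorem IsHermitian.ofReal_re_trace {P : Matrix n n ℂ} (hP : P.IsHermitian) :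
    ((P.trace.re : ℝ) : ℂ) = P.trace := by
  rw [← Complex.conj_eq_iff_re, ← RCLike.star_def, ← trace_conjTranspose, hP.eq]

theorem IsHermitian.ofReal_re_trace_mul {P Q : Matrix n n ℂ} (hP : P.IsHermitian)
    (hQ : Q.IsHermitian) : (((P * Q).trace.re : ℝ) : ℂ) = (P * Q).trace := by
  rw [← Complex.conj_eq_iff_re, ← RCLike.star_def, ← trace_conjTranspose, conjTranspose_mul,
    hP.eq, hQ.eq, trace_mul_comm]

variable [DecidableEq n]

/-- The Hermitian matrix with eigenvalues `a` in the eigenbasis given by the columns of `U`. -/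
noncomputable def conjDiagonal (U : unitary (Matrix n n ℂ)) (a : n → ℝ) : Matrix n n ℂ :=
  (U : Matrix n n ℂ) * diagonal (fun i => (a i : ℂ)) * star (U : Matrix n n ℂ)

theorem conjDiagonal_one (U : unitary (Matrix n n ℂ)) : conjDiagonal U (fun _ => 1) = 1 := by
  simp [conjDiagonal]

theorem conjDiagonal_mul (U : unitary (Matrix n n ℂ)) (a b : n → ℝ) :
    conjDiagonal U a * conjDiagonal U b = conjDiagonal U (fun i => a i * b i) := by
  have h : star (U : Matrix n n ℂ) * (U : Matrix n n ℂ) = 1 := by simp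
  calc _ = (U : Matrix n n ℂ) * diagonal (fun i => (a i : ℂ))
        * (star (U : Matrix n n ℂ) * (U : Matrix n n ℂ))
        * diagonal (fun i => (b i : ℂ)) * star (U : Matrix n n ℂ) := by
        simp only [conjDiagonal, Matrix.mul_assoc]
    _ = _ := by
        rw [h, Matrix.mul_one, Matrix.mul_assoc (U : Matrix n n ℂ), diagonal_mul_diagonal]
        simp [conjDiagonal]

theorem IsHermitian.cfc_eq_conjDiagonal {A : Matrix n n ℂ} (hA : A.IsHermitian) (f : ℝ → ℝ) :
    _root_.cfc f A = conjDiagonal hA.eigenvectorUnitary (fun i => f (hA.eigenvalues i)) := by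
  rw [hA.cfc_eq, IsHermitian.cfc, Unitary.conjStarAlgAut_apply]
  rfl

theorem IsHermitian.eq_conjDiagonal {A : Matrix n n ℂ} (hA : A.IsHermitian) :
    A = conjDiagonal hA.eigenvectorUnitary hA.eigenvalues := by
  conv_lhs => rw [hA.spectral_theorem, Unitary.conjStarAlgAut_apply]
  rfl

theorem PosDef.exists_conjDiagonal {A : Matrix n n ℂ} (hA : A.PosDef) :
    ∃ (U : unitary (Matrix n n ℂ)) (a : n → ℝ), (∀ i, 0 < a i) ∧ A = conjDiagonal U a ∧
      CFC.log A = conjDiagonal U (fun i => Real.log (a i)) :=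
  ⟨hA.1.eigenvectorUnitary, hA.1.eigenvalues, hA.eigenvalues_pos, hA.1.eq_conjDiagonal,
    hA.1.cfc_eq_conjDiagonal Real.log⟩

/-- In the two eigenbases the trace forms decouple over the entries of `U* K V`, which reduces
matrix claims to scalar ones. -/
theorem trace_conjTranspose_mul_conjDiagonal (U V : unitary (Matrix n n ℂ)) (a b : n → ℝ)
    (K : Matrix n n ℂ) :
    (Kᴴ * conjDiagonal U a * K * conjDiagonal V b).trace =
      ((∑ i, ∑ j, a i * b j *
        Complex.normSq ((star (U : Matrix n n ℂ) * K * (V : Matrix n n ℂ)) i j) : ℝ) : ℂ) := by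
  set W := star (U : Matrix n n ℂ) * K * (V : Matrix n n ℂ) with hW
  have hW' : Wᴴ = star (V : Matrix n n ℂ) * Kᴴ * (U : Matrix n n ℂ) := by
    simp [hW, star_eq_conjTranspose, Matrix.mul_assoc]
  have h1 : (Kᴴ * conjDiagonal U a * K * conjDiagonal V b).trace
      = (Wᴴ * diagonal (fun i => (a i : ℂ)) * W * diagonal (fun i => (b i : ℂ))).trace := by
    have e : Kᴴ * conjDiagonal U a * K * conjDiagonal V b
        = (Kᴴ * (U : Matrix n n ℂ) * diagonal (fun i => (a i : ℂ)) * W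
          * diagonal (fun i => (b i : ℂ))) * star (V : Matrix n n ℂ) := by
      simp only [conjDiagonal, hW, Matrix.mul_assoc]
    rw [e, trace_mul_comm, hW']
    simp only [Matrix.mul_assoc]
  rw [h1, trace, Finset.sum_comm]
  push_cast
  refine Finset.sum_congr rfl fun j _ => ?_
  rw [diag_apply, mul_diagonal, mul_apply, Finset.sum_mul]
  refine Finset.sum_congr rfl fun i _ => ?_
  rw [mul_diagonal, conjTranspose_apply, Complex.normSq_eq_conj_mul_self]
  simp only [RCLike.star_def]
  ring

/-- The generalized relative entropy `Tr (K* A (log A) K) - Tr (K* A K log B)`. -/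
noncomputable def liebEntropy (K A B : Matrix n n ℂ) : ℝ :=
  (Kᴴ * (A * CFC.log A) * K - Kᴴ * A * K * CFC.log B).trace.re

/-- Here `φ s` is the minimum of the functional over `X`; the existential hides the eigenbases,
which differ from one pair `(A, B)` to another. -/
theorem PosDef.exists_liebEntropy_eq_integral (K : Matrix n n ℂ) {A B : Matrix n n ℂ}
    (hA : A.PosDef) (hB : B.PosDef) :
    ∃ φ : ℝ → ℝ,
      (∀ s, 0 < s → ∀ X, φ s ≤ parallelFunctional K A B s X) ∧
      (∀ s, 0 < s → ∃ X, φ s = parallelFunctional K A B s X) ∧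
      IntegrableOn (fun s => (Kᴴ * A * K).trace.re / (1 + s) - φ s) (Ioi 0) ∧
      ∫ s in Ioi (0 : ℝ), ((Kᴴ * A * K).trace.re / (1 + s) - φ s) = liebEntropy K A B := by
  obtain ⟨U, a, ha, hAa, hlA⟩ := hA.exists_conjDiagonal
  obtain ⟨V, b, hb, hBb, hlB⟩ := hB.exists_conjDiagonal
  let W : Matrix n n ℂ → Matrix n n ℂ := fun X =>
    star (U : Matrix n n ℂ) * X * (V : Matrix n n ℂ)
  have hWsub : ∀ X i j, W (K - X) i j = W K i j - W X i j := fun X i j => by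
    simp [W, Matrix.mul_sub, Matrix.sub_mul]
  have htrA : ∀ X, (Xᴴ * A * X).trace.re = ∑ i, ∑ j, a i * Complex.normSq (W X i j) := by
    intro X
    have h := trace_conjTranspose_mul_conjDiagonal U V a (fun _ => 1) X
    rw [conjDiagonal_one, Matrix.mul_one, ← hAa] at h
    rw [h, Complex.ofReal_re]
    simp [W]
  have htrB : ∀ X, (Xᴴ * X * B).trace.re = ∑ i, ∑ j, b j * Complex.normSq (W X i j) := by
    intro X
    have h := trace_conjTranspose_mul_conjDiagonal U V (fun _ => 1) b X
    rw [conjDiagonal_one, Matrix.mul_one, ← hBb] at h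
    rw [h, Complex.ofReal_re]
    simp [W]
  have hpar : ∀ s X, parallelFunctional K A B s X = ∑ i, ∑ j,
      (a i * Complex.normSq (W X i j) / s + b j * Complex.normSq (W K i j - W X i j)) := by
    intro s X
    simp only [parallelFunctional, htrA, htrB, hWsub, Finset.sum_div, Finset.sum_add_distrib]
  have hlieb : liebEntropy K A B = ∑ i, ∑ j,
      (a i * Real.log (a i) - a i * Real.log (b j)) * Complex.normSq (W K i j) := by
    have h1 := trace_conjTranspose_mul_conjDiagonal U V (fun i => a i * Real.log (a i))
      (fun _ => 1) K
    have h2 := trace_conjTranspose_mul_conjDiagonal U V a (fun j => Real.log (b j)) K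
    rw [conjDiagonal_one, Matrix.mul_one, ← conjDiagonal_mul, ← hAa, ← hlA] at h1
    rw [← hAa, ← hlB] at h2
    rw [liebEntropy, trace_sub, h1, h2, Complex.sub_re, Complex.ofReal_re, Complex.ofReal_re,
      ← Finset.sum_sub_distrib]
    refine Finset.sum_congr rfl fun i _ => ?_
    rw [← Finset.sum_sub_distrib]
    refine Finset.sum_congr rfl fun j _ => ?_
    simp only [W]
    ring
  have hint : ∀ i j, IntegrableOn (fun s => (a i / (1 + s) - a i * b j / (a i + s * b j))
      * Complex.normSq (W K i j)) (Ioi 0) := fun i j =>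
    (integrableOn_div_sub_parallel (ha i) (hb j)).mul_const _
  have hfun : (fun s => (Kᴴ * A * K).trace.re / (1 + s)
      - ∑ i, ∑ j, a i * b j / (a i + s * b j) * Complex.normSq (W K i j))
      = fun s => ∑ i, ∑ j, (a i / (1 + s) - a i * b j / (a i + s * b j))
        * Complex.normSq (W K i j) := by
    funext s
    rw [htrA, Finset.sum_div, ← Finset.sum_sub_distrib]
    refine Finset.sum_congr rfl fun i _ => ?_
    rw [Finset.sum_div, ← Finset.sum_sub_distrib]
    refine Finset.sum_congr rfl fun j _ => ?_
    ring
  refine ⟨fun s => ∑ i, ∑ j, a i * b j / (a i + s * b j) * Complex.normSq (W K i j),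
    fun s hs X => ?_, fun s hs => ?_, ?_, ?_⟩
  · rw [hpar]
    exact Finset.sum_le_sum fun i _ => Finset.sum_le_sum fun j _ =>
      parallel_mul_normSq_le (ha i) (hb j) hs _ _
  -- The scalar minimizer, entry by entry, then rotated back.
  · let Y : Matrix n n ℂ := of fun i j => ((s * b j / (a i + s * b j) : ℝ) : ℂ) * W K i j
    refine ⟨(U : Matrix n n ℂ) * Y * star (V : Matrix n n ℂ), ?_⟩
    have hY : W ((U : Matrix n n ℂ) * Y * star (V : Matrix n n ℂ)) = Y := by
      have hU : star (U : Matrix n n ℂ) * (U : Matrix n n ℂ) = 1 := by simp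
      have hV : star (V : Matrix n n ℂ) * (V : Matrix n n ℂ) = 1 := by simp
      calc _ = (star (U : Matrix n n ℂ) * (U : Matrix n n ℂ)) * Y
            * (star (V : Matrix n n ℂ) * (V : Matrix n n ℂ)) := by
            simp only [W, Matrix.mul_assoc]
        _ = Y := by rw [hU, hV, Matrix.one_mul, Matrix.mul_one]
    rw [hpar, hY]
    exact Finset.sum_congr rfl fun i _ => Finset.sum_congr rfl fun j _ =>
      parallel_mul_normSq_eq (ha i) (hb j) hs _
  · rw [hfun]
    exact integrable_finsetSum _ fun i _ => integrable_finsetSum _ fun j _ => hint i j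
  · simp only [hfun]
    rw [integral_finsetSum _ fun i _ => integrable_finsetSum _ fun j _ => hint i j, hlieb]
    refine Finset.sum_congr rfl fun i _ => ?_
    rw [integral_finsetSum _ fun j _ => hint i j]
    refine Finset.sum_congr rfl fun j _ => ?_
    rw [integral_mul_const, integral_div_sub_parallel (ha i) (hb j)]

theorem liebEntropy_convexComb_le (K : Matrix n n ℂ) {A₁ A₂ B₁ B₂ : Matrix n n ℂ}
    (hA₁ : A₁.PosDef) (hA₂ : A₂.PosDef) (hB₁ : B₁.PosDef) (hB₂ : B₂.PosDef) {p q : ℝ}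
    (hp : 0 ≤ p) (hq : 0 ≤ q) (hpq : p + q = 1) :
    liebEntropy K (p • A₁ + q • A₂) (p • B₁ + q • B₂)
      ≤ p * liebEntropy K A₁ B₁ + q * liebEntropy K A₂ B₂ := by
  obtain ⟨φ₁, hle₁, -, hint₁, heq₁⟩ := hA₁.exists_liebEntropy_eq_integral K hB₁
  obtain ⟨φ₂, hle₂, -, hint₂, heq₂⟩ := hA₂.exists_liebEntropy_eq_integral K hB₂
  obtain ⟨φ, -, hex, hint, heq⟩ :=
    (hA₁.convexComb hA₂ hp hq hpq).exists_liebEntropy_eq_integral K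
      (hB₁.convexComb hB₂ hp hq hpq)
  rw [← heq, ← heq₁, ← heq₂, ← integral_const_mul, ← integral_const_mul,
    ← integral_add (hint₁.const_mul p) (hint₂.const_mul q)]
  refine setIntegral_mono_on hint ((hint₁.const_mul p).add (hint₂.const_mul q))
    measurableSet_Ioi fun s hs => ?_
  -- The minimizer for the combined pair serves as a competitor for both given pairs.
  obtain ⟨X, hX⟩ := hex s hs
  rw [hX, parallelFunctional_convexComb]
  have h₁ := mul_le_mul_of_nonneg_left (hle₁ s hs X) hp
  have h₂ := mul_le_mul_of_nonneg_left (hle₂ s hs X) hq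
  have htr : (Kᴴ * (p • A₁ + q • A₂) * K).trace.re
      = p * (Kᴴ * A₁ * K).trace.re + q * (Kᴴ * A₂ * K).trace.re := by
    simp only [Matrix.mul_add, Matrix.add_mul, Matrix.mul_smul, Matrix.smul_mul,
      trace_add, trace_smul, Complex.add_re, Complex.smul_re, smul_eq_mul]
  rw [htr, add_div, mul_div_assoc, mul_div_assoc]
  linarith

/-! ### Reduction of the contraction case -/

open scoped MatrixOrder in
theorem exists_mul_conjTranspose_add_eq_one {H : Matrix n n ℂ} (hH : ‖H‖ ≤ 1) :
    ∃ K : Matrix n n ℂ, H * Hᴴ + K * Kᴴ = 1 := by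
  have h : H * Hᴴ ≤ 1 := by
    rw [← star_eq_conjTranspose]
    refine (CStarAlgebra.norm_le_one_iff_of_nonneg _ (mul_star_self_nonneg H)).1 ?_
    rw [CStarRing.norm_self_mul_star]
    exact mul_le_one₀ hH (norm_nonneg _) hH
  obtain ⟨K, hK⟩ := CStarAlgebra.nonneg_iff_eq_star_mul_self.1 (sub_nonneg.2 h)
  rw [star_eq_conjTranspose] at hK
  exact ⟨Kᴴ, by rw [conjTranspose_conjTranspose, ← hK]; abel⟩

end Matrix

open Matrix in
theorem ofReal_reducedRelativeEntropy {n : Type*} [Fintype n] [DecidableEq n]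
    (H : Matrix n n ℂ) {A B : Matrix n n ℂ} (hA : A.IsHermitian) (hB : B.IsHermitian) :
    ((reducedRelativeEntropy H A B : ℝ) : ℂ) = reducedRelativeEntropyTrace H A B := by
  have hlog (C : Matrix n n ℂ) : (CFC.log C).IsHermitian := IsSelfAdjoint.log
  simp only [reducedRelativeEntropy, reducedRelativeEntropyTrace, trace_add, trace_sub,
    Complex.add_re, Complex.sub_re, Complex.ofReal_add, Complex.ofReal_sub]
  rw [hA.ofReal_re_trace_mul (hlog A), hA.ofReal_re_trace, hB.ofReal_re_trace,
    (isHermitian_conjTranspose_mul_mul H hA).ofReal_re_trace_mul (hlog B)]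

open Matrix in
theorem reducedRelativeEntropy_eq_liebEntropy_add {n : Type*} [Fintype n] [DecidableEq n]
    {H K : Matrix n n ℂ} (hK : H * Hᴴ + K * Kᴴ = 1) (A B : Matrix n n ℂ) :
    reducedRelativeEntropy H A B
      = liebEntropy H A B + liebEntropy K A 1 + (B.trace.re - A.trace.re) := by
  have h : (A * CFC.log A).trace
      = (Hᴴ * (A * CFC.log A) * H).trace + (Kᴴ * (A * CFC.log A) * K).trace := by
    rw [Matrix.mul_assoc, trace_mul_comm Hᴴ, Matrix.mul_assoc Kᴴ, trace_mul_comm Kᴴ,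
      Matrix.mul_assoc _ H, Matrix.mul_assoc _ K, ← trace_add, ← Matrix.mul_add, hK,
      Matrix.mul_one]
  simp only [reducedRelativeEntropy, reducedRelativeEntropyTrace, liebEntropy, CFC.log_one,
    Matrix.mul_zero, sub_zero, trace_add, trace_sub, h, Complex.add_re, Complex.sub_re]
  ring

theorem theorem1 {n : Type*} [Fintype n] [DecidableEq n] (H : Matrix n n ℂ)
    (hH : IsContractionMatrix H) :
    (∀ A B : Matrix n n ℂ, A.PosDef → B.PosDef →
      ((reducedRelativeEntropy H A B : ℝ) : ℂ) = reducedRelativeEntropyTrace H A B) ∧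
    ConvexOn ℝ {p : Matrix n n ℂ × Matrix n n ℂ | p.1.PosDef ∧ p.2.PosDef}
      (fun p => reducedRelativeEntropy H p.1 p.2) := by
  refine ⟨fun A B hA hB => ofReal_reducedRelativeEntropy H hA.1 hB.1,
    fun x hx y hy p q hp hq hpq =>
      ⟨hx.1.convexComb hy.1 hp hq hpq, hx.2.convexComb hy.2 hp hq hpq⟩, ?_⟩
  rintro ⟨A₁, B₁⟩ ⟨hA₁, hB₁⟩ ⟨A₂, B₂⟩ ⟨hA₂, hB₂⟩ p q hp hq hpq
  obtain ⟨K, hK⟩ := Matrix.exists_mul_conjTranspose_add_eq_one hH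
  have h₁ := Matrix.liebEntropy_convexComb_le H hA₁ hA₂ hB₁ hB₂ hp hq hpq
  have h₂ := Matrix.liebEntropy_convexComb_le K hA₁ hA₂ Matrix.PosDef.one Matrix.PosDef.one
    hp hq hpq
  -- The second argument stays at `1`, as `p • 1 + q • 1 = 1`.
  rw [← add_smul, hpq, one_smul] at h₂
  simp only [Prod.smul_mk, Prod.mk_add_mk, reducedRelativeEntropy_eq_liebEntropy_add hK,
    Matrix.trace_add, Matrix.trace_smul, Complex.add_re, Complex.smul_re, smul_eq_mul]
  linarith
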